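/- Let $\mathcal X$ and $\mathcal A$ be finite nonempty alphabets and let $B$ be a finite-dimensional quantum system. An assemblage $\hat\rho=\{\hat\rho_B^{a,x}\}_{a\in\mathcal A,x\in\mathcal X}$ is a family of positive semidefinite operators on $B$ such that $\rho_B:=\sum_a\hat\rho_B^{a,x}$ does not depend on $x$ and is a quantum state. It has a local-hidden-state model, written $\hat\rho\in\operatorname{LHS}$, if $\hat\rho_B^{a,x}=\sum_\lambda p_\Lambda(\lambda)\,p_{\overline A|X\Lambda}(a|x,\lambda)\,\rho_B^\lambda$ for all $a,x$, with a probability distribution $p_\Lambda$ on a finite set, conditional probability distributions $p_{\overline A|X\Lambda}$ and quantum states $\rho_B^\lambda$. A 1W-LOCC operation $\{p_{X|Y},\{\mathcal K_y\}_y\}$ consists of a finite family of completely positive trace-non-increasing maps $\mathcal K_y$ from $B$ to a finite-dimensional system $B'$ such that $\sum_y\mathcal K_y$ is trace preserving, and of a conditional probability distribution $p_{X|Y}(x|y)$ on $\mathcal X$. It maps $\hat\rho$ to the state $$\rho_{X\overline AB'Y}:=\sum_{x,a,y}p_{X|Y}(x|y)\,|x\rangle\langle x|_X\otimes|a\rangle\langle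 a|_{\overline A}\otimes\mathcal K_y(\hat\rho_B^{a,x})\otimes|y\rangle\langle y|_Y .$$ The quantum relative entropy is $D(\omega\Vert\tau):=\operatorname{Tr}(\omega[\log_2\omega-\log_2\tau])$ (logarithms taken on the supports) if $\operatorname{supp}\omega\subseteq\operatorname{supp}\tau$, and $+\infty$ otherwise. The relative entropy of steering is $$R_S(\overline A;B)_{\hat\rho}:=\sup_{\{p_{X|Y},\{\mathcal K_y\}_y\}}\ \inf_{\hat\sigma\in\operatorname{LHS}}D(\rho_{X\overline AB'Y}\Vert\sigma_{X\overline AB'Y})\in[0,+\infty],$$ where $\sigma_{X\overline AB'Y}$ arises from $\hat\sigma$ in the same way as $\rho_{X\overline AB'Y}$ from $\hat\rho$. Proposition (faithfulness, converse direction). For every assemblage $\hat\rho=\{\hat\rho_B^{a,x}\}_{a,x}$, $$\sqrt{2\ln 2\;R_S(\overline A;B)_{\hat\rho}}\ \ge\ \inf_{\hat\sigma\in\operatorname{LHS}}\frac1{|\mathcal X|}\sum_{x,a}\left\Vert\hat\rho_B^{a,x}-\hat\sigma_B^{a,x}\right\Vert_1 ,$$ where $\Vert M\Vert_1=\operatorname{Tr}\sqrt{M^\dagger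 M}$. In particular, if $R_S(\overline A;B)_{\hat\rho}=0$, then $\hat\rho\in\operatorname{LHS}$. -/

import Mathlib

open scoped ComplexOrder Kronecker ENNReal

namespace Steering

noncomputable section

/-- A quantum state (density operator) on a finite-dimensional system. -/
def IsState {n : Type*} [Fintype n] (ρ : Matrix n n ℂ) : Prop :=
  ρ.PosSemidef ∧ ρ.trace = 1

/-- The trace norm `‖M‖₁ = Tr √(Mᴴ M)`. -/
def traceNorm {n : Type*} [Fintype n] [DecidableEq n] (M : Matrix n n ℂ) : ℝ :=
  (cfc Real.sqrt (M.conjTranspose * M)).trace.re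

/-- The support of a Hermitian matrix: the orthogonal complement of its kernel,
that is, its range. -/
def supp {n : Type*} [Fintype n] (M : Matrix n n ℂ) : Submodule ℂ (n → ℂ) :=
  LinearMap.range M.mulVecLin

/-- The base-two operator logarithm of a Hermitian matrix, taken on its support:
since `Real.logb 2 0 = 0`, it vanishes on the kernel. -/
def log2 {n : Type*} [Fintype n] [DecidableEq n] (M : Matrix n n ℂ) : Matrix n n ℂ :=
  cfc (Real.logb 2) M

open Classical in
/-- The quantum relative entropy `D(ρ‖σ) = Tr(ρ [log₂ ρ - log₂ σ])` if the support of `ρ` is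
contained in the support of `σ`, and `+∞` otherwise. -/
def relEntropy {n : Type*} [Fintype n] [DecidableEq n] (ρ σ : Matrix n n ℂ) : EReal :=
  if supp ρ ≤ supp σ then (((ρ * (log2 ρ - log2 σ)).trace.re : ℝ) : EReal) else ⊤

/-- An assemblage `{ρ̂^{a,x}}` on Bob's system `B` with input alphabet `X` and output
alphabet `A`: positive semidefinite operators that satisfy the no-signaling principle and whose
sum over the outputs is a quantum state. -/
@[ext]
structure Assemblage (X A B : Type*) [Fintype A] [Fintype B] where
  op : A → X → Matrix B B ℂ
  posSemidef : ∀ a x, (op a x).PosSemidef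
  noSignaling : ∀ x x', ∑ a, op a x = ∑ a, op a x'
  isState : ∀ x, IsState (∑ a, op a x)

/-- The set of assemblages with a local-hidden-state model
`ρ̂^{a,x} = ∑_l p(l) q(a|x,l) τ^l`. -/
def LHS (X A B : Type*) [Fintype A] [Fintype B] : Set (Assemblage X A B) :=
  {ρ | ∃ (n : ℕ) (p : Fin n → ℝ) (q : Fin n → X → A → ℝ) (τ : Fin n → Matrix B B ℂ),
    p ∈ stdSimplex ℝ (Fin n) ∧
    (∀ l x, q l x ∈ stdSimplex ℝ A) ∧
    (∀ l, IsState (τ l)) ∧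
    ∀ a x, ρ.op a x = ∑ l, ((p l * q l x a : ℝ) : ℂ) • τ l}

/-- The map `id_k ⊗ Φ`, acting blockwise on `k × k` block matrices. -/
def ampliation {m n : Type*} (Φ : Matrix m m ℂ →ₗ[ℂ] Matrix n n ℂ) (k : ℕ)
    (M : Matrix (Fin k × m) (Fin k × m) ℂ) : Matrix (Fin k × n) (Fin k × n) ℂ :=
  Matrix.of fun r s => Φ (Matrix.of fun i j => M (r.1, i) (s.1, j)) r.2 s.2

/-- Complete positivity: every `id_k ⊗ Φ` preserves positive semidefiniteness. -/
def IsCompletelyPositive {m n : Type*} (Φ : Matrix m m ℂ →ₗ[ℂ] Matrix n n ℂ) : Prop :=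
  ∀ (k : ℕ) (M : Matrix (Fin k × m) (Fin k × m) ℂ), M.PosSemidef → (ampliation Φ k M).PosSemidef

/-- A 1W-LOCC operation `{p_{X|Y}, {K_y}_y}`: Bob applies a generalized measurement with outcomes
`y` and output system `B'` of dimension `dimB'`, and communicates `y` to Alice, who chooses her
input `x` with probability `p(x|y)`. -/
structure OneWayLOCC (X B : Type*) [Fintype X] [Fintype B] where
  /-- The number of outcomes `y`. -/
  cardY : ℕ
  /-- The dimension of the output system. -/
  dimB' : ℕ
  p : Fin cardY → X → ℝ
  p_mem : ∀ y, p y ∈ stdSimplex ℝ X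
  K : Fin cardY → Matrix B B ℂ →ₗ[ℂ] Matrix (Fin dimB') (Fin dimB') ℂ
  completelyPositive : ∀ y, IsCompletelyPositive (K y)
  traceNonincreasing : ∀ y (M : Matrix B B ℂ), M.PosSemidef → (K y M).trace.re ≤ M.trace.re
  tracePreserving : ∀ M : Matrix B B ℂ, (∑ y, K y M).trace = M.trace

/-- The state `∑_{x,a,y} p(x|y) |x⟩⟨x| ⊗ |a⟩⟨a| ⊗ K_y(ρ̂^{a,x}) ⊗ |y⟩⟨y|`. -/
def OneWayLOCC.outputState {X A B : Type*} [Fintype X] [DecidableEq X] [Fintype A] [DecidableEq A]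
    [Fintype B] (L : OneWayLOCC X B) (ρ : Assemblage X A B) :
    Matrix (X × A × Fin L.dimB' × Fin L.cardY) (X × A × Fin L.dimB' × Fin L.cardY) ℂ :=
  ∑ x, ∑ a, ∑ y, (L.p y x : ℂ) •
    (Matrix.single x x (1 : ℂ) ⊗ₖ (Matrix.single a a (1 : ℂ) ⊗ₖ
      (L.K y (ρ.op a x) ⊗ₖ Matrix.single y y (1 : ℂ))))

/-- The relative entropy of steering: the supremum over 1W-LOCC operations of the infimum over
assemblages with a local-hidden-state model of the relative entropy of the output states. -/
def relEntropySteering {X A B : Type*} [Fintype X] [DecidableEq X] [Fintype A] [DecidableEq A]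
    [Fintype B] (ρ : Assemblage X A B) : EReal :=
  ⨆ L : OneWayLOCC X B, ⨅ σ ∈ LHS X A B, relEntropy (L.outputState ρ) (L.outputState σ)

end

end Steering

/-!
The 1W-LOCC operation in which Bob does nothing and Alice draws her input uniformly turns
assemblages into block-diagonal states whose trace distance is the averaged trace distance of the
assemblages, so the inequality is the quantum Pinsker inequality for this operation.

Quantum Pinsker: let `M`, `N` have eigenvalues `rᵢ`, `sⱼ` and eigenbases with overlaps `Oᵢⱼ`. The
doubly stochastic weights `|Oᵢⱼ|²` write `ln 2 · D(M‖N) - Tr M + Tr N` as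
`∑ |Oᵢⱼ|² sⱼ φ(rᵢ / sⱼ)` with `φ t = t ln t + 1 - t`. For the unitary `U` attaining the trace norm
of `M - N`, and `P` its matrix from the eigenbasis of `M` to that of `N`,
`Tr (U (M - N)) = ∑ Pⱼᵢ (rᵢ - sⱼ) Oᵢⱼ`. The scalar bound
`(r - s)² ≤ ⅔ (r + 2 s) s φ(r / s)` and Cauchy–Schwarz separate the `O`-weighted sum, which is the
relative entropy, from the `P`-weighted one, which is `⅔ (Tr M + 2 Tr N)` since the weights
`|Pⱼᵢ|²` are doubly stochastic as well.

If the relative entropy of steering vanishes, the assemblage is a limit of assemblages with a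
local-hidden-state model; these form the convex hull of a compact set in finite dimension, which
is closed by Carathéodory's theorem.
-/

namespace Steering

open Matrix InformationTheory

theorem three_halves_mul_sq_sub_one_le_mul_klFun {t : ℝ} (ht : 0 ≤ t) :
    3 / 2 * (t - 1) ^ 2 ≤ (t + 2) * klFun t := by
  -- The difference `f` is convex and vanishes to second order at `1`.
  set f : ℝ → ℝ := fun t => (t + 2) * klFun t - 3 / 2 * (t - 1) ^ 2
  have hf : ∀ t, 0 < t → HasDerivAt f (2 * (t + 1) * Real.log t - 4 * (t - 1)) t := fun t ht => by
    refine ((((hasDerivAt_id t).add_const 2).mul (hasDerivAt_klFun ht.ne')).sub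
      ((((hasDerivAt_id t).sub_const 1).pow 2).const_mul (3 / 2))).congr_deriv ?_
    simp only [klFun, id]
    ring
  have hf' : ∀ t, 0 < t → HasDerivAt (fun t => 2 * (t + 1) * Real.log t - 4 * (t - 1))
      (2 * (Real.log t - (1 - t⁻¹))) t := fun t ht => by
    refine (((((hasDerivAt_id t).add_const 1).const_mul 2).mul (Real.hasDerivAt_log ht.ne')).sub
      (((hasDerivAt_id t).sub_const 1).const_mul 4)).congr_deriv ?_
    simp only [id]
    field_simp
    ring
  have hconv : ConvexOn ℝ (Set.Ici 0) f := by
    refine convexOn_of_hasDerivWithinAt2_nonneg (convex_Ici 0) (by fun_prop)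
      (fun t ht => (hf t ?_).hasDerivWithinAt) (fun t ht => (hf' t ?_).hasDerivWithinAt)
      fun t ht => ?_
    all_goals rw [interior_Ici] at ht
    · exact ht
    · exact ht
    · exact mul_nonneg two_pos.le (sub_nonneg.2 (Real.one_sub_inv_le_log_of_pos ht))
  have hmin : IsMinOn f (Set.Ici 0) 1 := by
    refine hconv.isMinOn_of_rightDeriv_eq_zero (by simp) ?_
    rw [(hf 1 one_pos).hasDerivWithinAt.derivWithin (uniqueDiffWithinAt_Ioi 1)]
    simp
  have h1 : f 1 ≤ f t := hmin ht
  simpa [f, klFun_one, sub_nonneg] using h1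

theorem mul_klFun_div {r s : ℝ} (h : s = 0 → r = 0) :
    s * klFun (r / s) = r * (Real.log r - Real.log s) - r + s := by
  rcases eq_or_ne s 0 with rfl | hs
  · simp [h rfl]
  rcases eq_or_ne r 0 with rfl | hr
  · simp [klFun_zero]
  rw [klFun_apply, Real.log_div hr hs]
  field_simp
  ring

theorem sq_sub_le_mul_mul_klFun_div {r s : ℝ} (hr : 0 ≤ r) (hs : 0 ≤ s) (h : s = 0 → r = 0) :
    (r - s) ^ 2 ≤ 2 / 3 * (r + 2 * s) * (s * klFun (r / s)) := by
  rcases hs.eq_or_lt' with rfl | hs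
  · simp [h rfl]
  calc (r - s) ^ 2 = 2 / 3 * s ^ 2 * (3 / 2 * (r / s - 1) ^ 2) := by field_simp
    _ ≤ 2 / 3 * s ^ 2 * ((r / s + 2) * klFun (r / s)) := by
        gcongr ?_ * ?_
        exact three_halves_mul_sq_sub_one_le_mul_klFun (by positivity)
    _ = 2 / 3 * (r + 2 * s) * (s * klFun (r / s)) := by field_simp

theorem sum_sum_mul_add_of_mem_doublyStochastic {R n : Type*} [Fintype n] [DecidableEq n]
    [Semiring R] [PartialOrder R] [IsOrderedRing R] {Q : Matrix n n R}
    (hQ : Q ∈ doublyStochastic R n) (u v : n → R) :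
    ∑ i, ∑ j, Q i j * (u i + v j) = ∑ i, u i + ∑ j, v j := by
  simp only [mul_add, Finset.sum_add_distrib]
  congr 1
  · simp only [← Finset.sum_mul, sum_row_of_mem_doublyStochastic hQ, one_mul]
  · rw [Finset.sum_comm]
    simp only [← Finset.sum_mul, sum_col_of_mem_doublyStochastic hQ, one_mul]

section Spectral

variable {𝕜 n : Type*} [RCLike 𝕜] [Fintype n] [DecidableEq n]

theorem cfc_eq_eigenvectorUnitary_mul {M : Matrix n n 𝕜} (hM : M.IsHermitian) (f : ℝ → ℝ) :
    cfc f M = (hM.eigenvectorUnitary : Matrix n n 𝕜) *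
      diagonal (fun i => (f (hM.eigenvalues i) : 𝕜)) *
      star (hM.eigenvectorUnitary : Matrix n n 𝕜) := by
  rw [hM.cfc_eq, IsHermitian.cfc, Unitary.conjStarAlgAut_apply]
  rfl

theorem trace_cfc {M : Matrix n n 𝕜} (hM : M.IsHermitian) (f : ℝ → ℝ) :
    (cfc f M).trace = ∑ i, (f (hM.eigenvalues i) : 𝕜) := by
  rw [cfc_eq_eigenvectorUnitary_mul hM, trace_mul_comm, ← Matrix.mul_assoc,
    Unitary.coe_star_mul_self, Matrix.one_mul, trace_diagonal]

theorem of_norm_sq_unitary_mem_doublyStochastic (U : unitaryGroup n 𝕜) :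
    of (fun i j => ‖(U : Matrix n n 𝕜) i j‖ ^ 2) ∈ doublyStochastic ℝ n := by
  refine mem_doublyStochastic_iff_sum.2 ⟨fun i j => sq_nonneg _, fun i => ?_, fun j => ?_⟩
  · have h := congrFun₂ (mem_unitaryGroup_iff.1 U.2) i i
    simp only [mul_apply, star_apply, RCLike.star_def, RCLike.mul_conj, one_apply_eq] at h
    simp only [of_apply]
    exact_mod_cast h
  · have h := congrFun₂ (mem_unitaryGroup_iff'.1 U.2) j j
    simp only [mul_apply, star_apply, RCLike.star_def, RCLike.conj_mul, one_apply_eq] at h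
    simp only [of_apply]
    exact_mod_cast h

/-- The unitary matrix of overlaps `⟪eᵢ, fⱼ⟫` between the eigenbases of two Hermitian matrices. -/
noncomputable def overlap {M N : Matrix n n 𝕜} (hM : M.IsHermitian) (hN : N.IsHermitian) :
    unitaryGroup n 𝕜 :=
  star hM.eigenvectorUnitary * hN.eigenvectorUnitary

theorem coe_overlap {M N : Matrix n n 𝕜} (hM : M.IsHermitian) (hN : N.IsHermitian) :
    (overlap hM hN : Matrix n n 𝕜) =
      star (hM.eigenvectorUnitary : Matrix n n 𝕜) * hN.eigenvectorUnitary := rfl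

theorem trace_cfc_mul_cfc {M N : Matrix n n 𝕜} (hM : M.IsHermitian) (hN : N.IsHermitian)
    (f g : ℝ → ℝ) :
    (cfc f M * cfc g N).trace = ∑ i, ∑ j, ((‖(overlap hM hN : Matrix n n 𝕜) i j‖ ^ 2 *
      (f (hM.eigenvalues i) * g (hN.eigenvalues j)) : ℝ) : 𝕜) := by
  have h : (cfc f M * cfc g N).trace =
      (diagonal (fun i => (f (hM.eigenvalues i) : 𝕜)) * (overlap hM hN : Matrix n n 𝕜) *
        (diagonal (fun j => (g (hN.eigenvalues j) : 𝕜)) *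
          star (overlap hM hN : Matrix n n 𝕜))).trace := by
    rw [cfc_eq_eigenvectorUnitary_mul hM, cfc_eq_eigenvectorUnitary_mul hN, coe_overlap, star_mul,
      star_star]
    simp only [Matrix.mul_assoc]
    rw [trace_mul_comm]
    simp only [Matrix.mul_assoc]
  rw [h, trace]
  refine Finset.sum_congr rfl fun i _ => ?_
  rw [diag_apply, mul_apply]
  refine Finset.sum_congr rfl fun j _ => ?_
  rw [diagonal_mul, diagonal_mul, star_apply, RCLike.star_def]
  push_cast
  rw [← RCLike.mul_conj]
  ring

theorem star_eigenvectorUnitary_mul_sub_mul_apply {M N : Matrix n n 𝕜} (hM : M.IsHermitian)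
    (hN : N.IsHermitian) (i j : n) :
    (star (hM.eigenvectorUnitary : Matrix n n 𝕜) * (M - N) * hN.eigenvectorUnitary) i j =
      (hM.eigenvalues i - hN.eigenvalues j) * (overlap hM hN : Matrix n n 𝕜) i j := by
  have hV : star (hM.eigenvectorUnitary : Matrix n n 𝕜) * M =
      diagonal (fun i => (hM.eigenvalues i : 𝕜)) * star (hM.eigenvectorUnitary : Matrix n n 𝕜) := by
    have h := cfc_eq_eigenvectorUnitary_mul hM fun x => x
    rw [cfc_id' ℝ M hM.isSelfAdjoint] at h
    refine (congrArg (star (hM.eigenvectorUnitary : Matrix n n 𝕜) * ·) h).trans ?_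
    simp only [← Matrix.mul_assoc, Unitary.coe_star_mul_self, Matrix.one_mul]
  have hW : N * hN.eigenvectorUnitary =
      (hN.eigenvectorUnitary : Matrix n n 𝕜) * diagonal (fun j => (hN.eigenvalues j : 𝕜)) := by
    have h := cfc_eq_eigenvectorUnitary_mul hN fun x => x
    rw [cfc_id' ℝ N hN.isSelfAdjoint] at h
    refine (congrArg (· * (hN.eigenvectorUnitary : Matrix n n 𝕜)) h).trans ?_
    simp only [Matrix.mul_assoc, Unitary.coe_star_mul_self, Matrix.mul_one]
  rw [Matrix.mul_sub, Matrix.sub_mul, Matrix.mul_assoc _ N, hV, hW, Matrix.mul_assoc,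
    ← Matrix.mul_assoc (star _), ← coe_overlap, Matrix.sub_apply, diagonal_mul, mul_diagonal,
    sub_mul, mul_comm (_ : 𝕜) (hN.eigenvalues j : 𝕜)]

theorem trace_mul_sub_eq_sum {M N : Matrix n n 𝕜} (hM : M.IsHermitian) (hN : N.IsHermitian)
    (U : Matrix n n 𝕜) :
    (U * (M - N)).trace = ∑ p : n × n,
      (star (hN.eigenvectorUnitary : Matrix n n 𝕜) * U * hM.eigenvectorUnitary) p.2 p.1 *
        ((hM.eigenvalues p.1 - hN.eigenvalues p.2) * (overlap hM hN : Matrix n n 𝕜) p.1 p.2) := by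
  set V : Matrix n n 𝕜 := ↑hM.eigenvectorUnitary
  set W : Matrix n n 𝕜 := ↑hN.eigenvectorUnitary
  calc (U * (M - N)).trace = (U * (V * star V) * (M - N) * (W * star W)).trace := by
        rw [show V * star V = 1 from mem_unitaryGroup_iff.1 hM.eigenvectorUnitary.2,
          show W * star W = 1 from mem_unitaryGroup_iff.1 hN.eigenvectorUnitary.2,
          Matrix.mul_one, Matrix.mul_one]
    _ = ((star W * U * V) * (star V * (M - N) * W)).trace := by
        rw [← Matrix.mul_assoc _ W, trace_mul_comm]
        simp only [Matrix.mul_assoc]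
    _ = _ := by
        simp only [trace, diag_apply, mul_apply (M := star W * U * V),
          star_eigenvectorUnitary_mul_sub_mul_apply, V, W]
        rw [Finset.sum_comm, Fintype.sum_prod_type]

end Spectral

section TraceNorm

theorem trace_submatrix_equiv {m n R : Type*} [Fintype m] [Fintype n] [AddCommMonoid R]
    (M : Matrix n n R) (e : m ≃ n) :
    (M.submatrix e e).trace = M.trace :=
  e.sum_comp fun i => M i i

open scoped MatrixOrder

theorem posSemidef_blockDiagonal {𝕜 m o : Type*} [RCLike 𝕜] [Finite m] [Finite o] [DecidableEq o]
    {M : o → Matrix m m 𝕜} (hM : ∀ k, (M k).PosSemidef) : (blockDiagonal M).PosSemidef := by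
  classical
  cases nonempty_fintype m
  cases nonempty_fintype o
  have h : M = fun k => (CFC.sqrt (M k))ᴴ * CFC.sqrt (M k) := funext fun k => by
    rw [(CFC.sqrt_nonneg (M k)).posSemidef.isHermitian.eq,
      CFC.sqrt_mul_sqrt_self (M k) (hM k).nonneg]
  rw [h, blockDiagonal_mul, ← blockDiagonal_conjTranspose]
  exact posSemidef_conjTranspose_mul_self _

variable {m n o : Type*} [Fintype m] [DecidableEq m] [Fintype n] [DecidableEq n] [Fintype o]
  [DecidableEq o]

theorem traceNorm_eq_re_trace_abs (M : Matrix n n ℂ) : traceNorm M = (CFC.abs M).trace.re := by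
  have h : 0 ≤ Mᴴ * M := (posSemidef_conjTranspose_mul_self M).nonneg
  rw [traceNorm, CFC.abs, star_eq_conjTranspose, CFC.sqrt_eq_real_sqrt _ h, cfcₙ_eq_cfc]

theorem traceNorm_eq_re_trace_of_mul_self_eq {M S : Matrix n n ℂ} (hS : S.PosSemidef)
    (h : S * S = Mᴴ * M) : traceNorm M = S.trace.re := by
  rw [traceNorm_eq_re_trace_abs, CFC.abs, star_eq_conjTranspose, CFC.sqrt_unique h hS.nonneg]

theorem traceNorm_of_posSemidef {M : Matrix n n ℂ} (hM : M.PosSemidef) :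
    traceNorm M = M.trace.re :=
  traceNorm_eq_re_trace_of_mul_self_eq hM (by rw [hM.isHermitian.eq])

theorem traceNorm_nonneg (M : Matrix n n ℂ) : 0 ≤ traceNorm M := by
  rw [traceNorm_eq_re_trace_abs]
  exact (Complex.nonneg_iff.1 (CFC.abs_nonneg M).posSemidef.trace_nonneg).1

theorem traceNorm_smul (c : ℂ) (M : Matrix n n ℂ) : traceNorm (c • M) = ‖c‖ * traceNorm M := by
  rw [traceNorm_eq_re_trace_abs, CFC.abs_smul, trace_smul, Complex.smul_re, smul_eq_mul,
    traceNorm_eq_re_trace_abs]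

theorem traceNorm_submatrix_equiv (M : Matrix n n ℂ) (e : m ≃ n) :
    traceNorm (M.submatrix e e) = traceNorm M := by
  rw [traceNorm_eq_re_trace_of_mul_self_eq (S := (CFC.abs M).submatrix e e)
    ((CFC.abs_nonneg M).posSemidef.submatrix e), trace_submatrix_equiv, traceNorm_eq_re_trace_abs]
  rw [submatrix_mul_equiv, conjTranspose_submatrix, submatrix_mul_equiv, CFC.abs_mul_abs,
    star_eq_conjTranspose]

theorem traceNorm_blockDiagonal (M : o → Matrix m m ℂ) :
    traceNorm (blockDiagonal M) = ∑ k, traceNorm (M k) := by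
  rw [traceNorm_eq_re_trace_of_mul_self_eq (S := blockDiagonal fun k => CFC.abs (M k))
    (posSemidef_blockDiagonal fun k => (CFC.abs_nonneg (M k)).posSemidef)]
  · simp only [trace_blockDiagonal, Complex.re_sum, traceNorm_eq_re_trace_abs]
  · simp only [blockDiagonal_conjTranspose, ← blockDiagonal_mul, CFC.abs_mul_abs,
      star_eq_conjTranspose]

theorem exists_unitary_trace_mul_eq_traceNorm {M : Matrix n n ℂ} (hM : M.IsHermitian) :
    ∃ U : unitaryGroup n ℂ, ((U : Matrix n n ℂ) * M).trace.re = traceNorm M := by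
  have hc (f : ℝ → ℝ) : ContinuousOn f (spectrum ℝ M) := M.finite_real_spectrum.continuousOn f
  let g : ℝ → ℝ := fun x => if 0 ≤ x then 1 else -1
  have hgg (x : ℝ) : g x * g x = 1 := by unfold g; split_ifs <;> norm_num
  have hg (x : ℝ) : g x * x = ‖x‖ := by
    unfold g
    split_ifs with h
    · rw [one_mul, Real.norm_of_nonneg h]
    · rw [neg_one_mul, Real.norm_of_nonpos (not_le.1 h).le]
  have hU : cfc g M ∈ unitaryGroup n ℂ := by
    rw [mem_unitaryGroup_iff, IsSelfAdjoint.star_eq (cfc_predicate g M),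
      ← cfc_mul g g M (hc g) (hc g)]
    simp only [hgg, cfc_const_one ℝ M hM.isSelfAdjoint]
  refine ⟨⟨cfc g M, hU⟩, ?_⟩
  have hUM : cfc g M * M = CFC.abs M := by
    have h := cfc_mul g (fun x => x) M (hc g) (hc _)
    rw [cfc_id' ℝ M hM.isSelfAdjoint] at h
    rw [← h, CFC.abs_eq_cfc_norm M hM.isSelfAdjoint]
    simp only [hg]
  rw [hUM, traceNorm_eq_re_trace_abs]

theorem sum_norm_sq_le_sq_traceNorm (M : Matrix n n ℂ) :
    ∑ i, ∑ j, ‖M i j‖ ^ 2 ≤ traceNorm M ^ 2 := by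
  have hH := isHermitian_conjTranspose_mul_self M
  have hH0 := (posSemidef_conjTranspose_mul_self M).eigenvalues_nonneg
  calc ∑ i, ∑ j, ‖M i j‖ ^ 2 = (Mᴴ * M).trace.re := by
        rw [Finset.sum_comm]
        simp only [trace, diag_apply, mul_apply, conjTranspose_apply, RCLike.star_def,
          Complex.conj_mul', Complex.re_sum]
        norm_cast
    _ = ∑ i, √(hH.eigenvalues i) ^ 2 := by
        rw [hH.trace_eq_sum_eigenvalues, Complex.re_sum]
        exact Finset.sum_congr rfl fun i _ => (Real.sq_sqrt (hH0 i)).symm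
    _ ≤ (∑ i, √(hH.eigenvalues i)) ^ 2 :=
        Finset.sum_sq_le_sq_sum_of_nonneg fun i _ => Real.sqrt_nonneg _
    _ = traceNorm M ^ 2 := by
        rw [traceNorm, trace_cfc hH, Complex.re_sum]
        rfl

theorem norm_apply_le_traceNorm (M : Matrix n n ℂ) (i j : n) : ‖M i j‖ ≤ traceNorm M := by
  refine (sq_le_sq₀ (norm_nonneg _) (traceNorm_nonneg M)).1 (le_trans ?_
    (sum_norm_sq_le_sq_traceNorm M))
  calc ‖M i j‖ ^ 2 ≤ ∑ j, ‖M i j‖ ^ 2 :=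
        Finset.single_le_sum (f := fun j => ‖M i j‖ ^ 2) (fun _ _ => sq_nonneg _)
          (Finset.mem_univ j)
    _ ≤ ∑ i, ∑ j, ‖M i j‖ ^ 2 :=
        Finset.single_le_sum (f := fun i => ∑ j, ‖M i j‖ ^ 2)
          (fun _ _ => Finset.sum_nonneg fun _ _ => sq_nonneg _) (Finset.mem_univ i)

end TraceNorm

section Pinsker

variable {n : Type*} [Fintype n] [DecidableEq n] {M N : Matrix n n ℂ}

theorem overlap_eq_zero_of_supp_le (hM : M.IsHermitian) (hN : N.IsHermitian)
    (h : supp M ≤ supp N) {i j : n} (hi : hM.eigenvalues i ≠ 0) (hj : hN.eigenvalues j = 0) :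
    (overlap hM hN : Matrix n n ℂ) i j = 0 := by
  set v : n → ℂ := ⇑(hM.eigenvectorBasis i)
  set w : n → ℂ := ⇑(hN.eigenvectorBasis j) with hw
  have hMv : M *ᵥ v = hM.eigenvalues i • v := hM.mulVec_eigenvectorBasis i
  have hNw : N *ᵥ w = 0 := by rw [hw, hN.mulVec_eigenvectorBasis j, hj, zero_smul]
  obtain ⟨u, hu⟩ : v ∈ supp N := h ⟨(hM.eigenvalues i)⁻¹ • v, by
    rw [mulVecLin_apply, mulVec_smul, hMv, smul_smul, inv_mul_cancel₀ hi, one_smul]⟩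
  rw [mulVecLin_apply] at hu
  calc (overlap hM hN : Matrix n n ℂ) i j = star v ⬝ᵥ w := by
        rw [coe_overlap, mul_apply, dotProduct]
        simp only [star_apply, IsHermitian.eigenvectorUnitary_apply, Pi.star_apply, v, w]
    _ = star u ⬝ᵥ (N *ᵥ w) := by rw [← hu, star_mulVec, ← dotProduct_mulVec, hN.eq]
    _ = 0 := by rw [hNw, dotProduct_zero]

theorem log_two_mul_re_trace_mul_log2_sub (hM : M.IsHermitian) (hN : N.IsHermitian) :
    Real.log 2 * (M * (log2 M - log2 N)).trace.re =
      ∑ i, ∑ j, ‖(overlap hM hN : Matrix n n ℂ) i j‖ ^ 2 * (hM.eigenvalues i *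
        (Real.log (hM.eigenvalues i) - Real.log (hN.eigenvalues j))) := by
  have hc (f : ℝ → ℝ) : ContinuousOn f (spectrum ℝ M) := M.finite_real_spectrum.continuousOn f
  have hMM : M * log2 M = cfc (fun x => x * Real.logb 2 x) M * cfc (fun _ => (1 : ℝ)) N := by
    rw [cfc_const_one ℝ N hN.isSelfAdjoint, Matrix.mul_one,
      cfc_mul (fun x : ℝ => x) (Real.logb 2) M (hc _) (hc _), cfc_id' ℝ M hM.isSelfAdjoint, log2]
  have hMN : M * log2 N = cfc (fun x : ℝ => x) M * cfc (Real.logb 2) N := by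
    rw [cfc_id' ℝ M hM.isSelfAdjoint, log2]
  have hlog : Real.log 2 ≠ 0 := (Real.log_pos one_lt_two).ne'
  simp only [Matrix.mul_sub, trace_sub, Complex.sub_re, hMM, hMN, trace_cfc_mul_cfc hM hN,
    Complex.re_sum, ← Finset.sum_sub_distrib, Finset.mul_sum]
  refine Finset.sum_congr rfl fun i _ => Finset.sum_congr rfl fun j _ => ?_
  simp only [RCLike.ofReal_eq_complex_ofReal, Complex.ofReal_re, Real.logb]
  field_simp

theorem re_trace_eq_sum_eigenvalues (hM : M.IsHermitian) :
    M.trace.re = ∑ i, hM.eigenvalues i := by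
  simp only [hM.trace_eq_sum_eigenvalues, Complex.re_sum, RCLike.ofReal_eq_complex_ofReal,
    Complex.ofReal_re]

theorem sum_overlap_mul_klFun_div (hM : M.IsHermitian) (hN : N.IsHermitian)
    (h : supp M ≤ supp N) :
    ∑ i, ∑ j, ‖(overlap hM hN : Matrix n n ℂ) i j‖ ^ 2 *
        (hN.eigenvalues j * klFun (hM.eigenvalues i / hN.eigenvalues j)) =
      Real.log 2 * (M * (log2 M - log2 N)).trace.re - M.trace.re + N.trace.re := by
  have hterm (i j : n) : ‖(overlap hM hN : Matrix n n ℂ) i j‖ ^ 2 *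
        (hN.eigenvalues j * klFun (hM.eigenvalues i / hN.eigenvalues j)) =
      ‖(overlap hM hN : Matrix n n ℂ) i j‖ ^ 2 * (hM.eigenvalues i *
        (Real.log (hM.eigenvalues i) - Real.log (hN.eigenvalues j))) +
      ‖(overlap hM hN : Matrix n n ℂ) i j‖ ^ 2 * (-hM.eigenvalues i + hN.eigenvalues j) := by
    -- When only the denominator vanishes the quotient is junk, but then the overlap vanishes.
    by_cases hO : hN.eigenvalues j = 0 ∧ hM.eigenvalues i ≠ 0
    · simp [overlap_eq_zero_of_supp_le hM hN h hO.2 hO.1]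
    · rw [mul_klFun_div fun hj => by_contra fun hi => hO ⟨hj, hi⟩]
      ring
  have htr := sum_sum_mul_add_of_mem_doublyStochastic
    (of_norm_sq_unitary_mem_doublyStochastic (overlap hM hN))
    (fun i => -hM.eigenvalues i) hN.eigenvalues
  simp only [of_apply, Finset.sum_neg_distrib] at htr
  simp only [hterm, Finset.sum_add_distrib, htr, log_two_mul_re_trace_mul_log2_sub hM hN,
    re_trace_eq_sum_eigenvalues hM, re_trace_eq_sum_eigenvalues hN]
  ring

theorem sq_eigenvalues_sub_mul_overlap_le (hM : M.PosSemidef) (hN : N.PosSemidef)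
    (h : supp M ≤ supp N) (i j : n) :
    let r := hM.isHermitian.eigenvalues i
    let s := hN.isHermitian.eigenvalues j
    let o := ‖(overlap hM.isHermitian hN.isHermitian : Matrix n n ℂ) i j‖
    (|r - s| * o) ^ 2 ≤ 2 / 3 * (r + 2 * s) * (o ^ 2 * (s * klFun (r / s))) := by
  intro r s o
  by_cases hrs : s = 0 ∧ r ≠ 0
  · simp [o, overlap_eq_zero_of_supp_le hM.isHermitian hN.isHermitian h hrs.2 hrs.1]
  · have hsq := sq_sub_le_mul_mul_klFun_div (hM.eigenvalues_nonneg i) (hN.eigenvalues_nonneg j)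
      fun hs => by_contra fun hr => hrs ⟨hs, hr⟩
    rw [mul_pow, sq_abs]
    linear_combination o ^ 2 * hsq

theorem sq_norm_trace_unitary_mul_sub_le (hM : M.PosSemidef) (hN : N.PosSemidef)
    (h : supp M ≤ supp N) (U : unitaryGroup n ℂ) :
    ‖((U : Matrix n n ℂ) * (M - N)).trace‖ ^ 2 ≤
      2 / 3 * (M.trace.re + 2 * N.trace.re) *
        (Real.log 2 * (M * (log2 M - log2 N)).trace.re - M.trace.re + N.trace.re) := by
  set r := hM.isHermitian.eigenvalues
  set s := hN.isHermitian.eigenvalues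
  set O : Matrix n n ℂ := ↑(overlap hM.isHermitian hN.isHermitian)
  set P : unitaryGroup n ℂ :=
    star hN.isHermitian.eigenvectorUnitary * U * hM.isHermitian.eigenvectorUnitary
  have hr : ∀ i, 0 ≤ r i := hM.eigenvalues_nonneg
  have hs : ∀ j, 0 ≤ s j := hN.eigenvalues_nonneg
  have hterm (p : n × n) : (‖(P : Matrix n n ℂ) p.2 p.1‖ * (|r p.1 - s p.2| * ‖O p.1 p.2‖)) ^ 2 ≤
      (‖(P : Matrix n n ℂ) p.2 p.1‖ ^ 2 * (2 / 3 * r p.1 + 2 / 3 * (2 * s p.2))) *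
        (‖O p.1 p.2‖ ^ 2 * (s p.2 * klFun (r p.1 / s p.2))) := by
    rw [mul_pow]
    linear_combination
      ‖(P : Matrix n n ℂ) p.2 p.1‖ ^ 2 * sq_eigenvalues_sub_mul_overlap_le hM hN h p.1 p.2
  have hP : ∑ p : n × n, ‖(P : Matrix n n ℂ) p.2 p.1‖ ^ 2 * (2 / 3 * r p.1 + 2 / 3 * (2 * s p.2)) =
      2 / 3 * (M.trace.re + 2 * N.trace.re) := by
    rw [Fintype.sum_prod_type, Finset.sum_comm]
    have htr := sum_sum_mul_add_of_mem_doublyStochastic (of_norm_sq_unitary_mem_doublyStochastic P)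
      (fun j => 2 / 3 * (2 * s j)) (fun i => 2 / 3 * r i)
    simp only [of_apply, ← Finset.mul_sum] at htr
    simp only [add_comm (2 / 3 * r _), htr, re_trace_eq_sum_eigenvalues hM.isHermitian,
      re_trace_eq_sum_eigenvalues hN.isHermitian]
    ring
  calc ‖((U : Matrix n n ℂ) * (M - N)).trace‖ ^ 2
      ≤ (∑ p : n × n, ‖(P : Matrix n n ℂ) p.2 p.1‖ * (|r p.1 - s p.2| * ‖O p.1 p.2‖)) ^ 2 := by
        rw [trace_mul_sub_eq_sum hM.isHermitian hN.isHermitian]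
        gcongr
        refine (norm_sum_le _ _).trans_eq (Finset.sum_congr rfl fun p _ => ?_)
        rw [norm_mul, norm_mul, ← RCLike.ofReal_sub, RCLike.norm_ofReal]
        rfl
    _ ≤ _ := Finset.sum_sq_le_sum_mul_sum_of_sq_le_mul _
        (fun p _ => mul_nonneg (sq_nonneg _) (by linarith [hr p.1, hs p.2]))
        (fun p _ => mul_nonneg (sq_nonneg _)
          (mul_nonneg (hs _) (klFun_nonneg (div_nonneg (hr _) (hs _)))))
        (fun p _ => hterm p)
    _ = _ := by
        rw [hP, ← sum_overlap_mul_klFun_div hM.isHermitian hN.isHermitian h,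
          Fintype.sum_prod_type]

theorem sq_traceNorm_sub_le (hM : M.PosSemidef) (hN : N.PosSemidef) (h : supp M ≤ supp N) :
    traceNorm (M - N) ^ 2 ≤ 2 / 3 * (M.trace.re + 2 * N.trace.re) *
      (Real.log 2 * (M * (log2 M - log2 N)).trace.re - M.trace.re + N.trace.re) := by
  obtain ⟨U, hU⟩ := exists_unitary_trace_mul_eq_traceNorm (hM.isHermitian.sub hN.isHermitian)
  refine le_trans ?_ (sq_norm_trace_unitary_mul_sub_le hM hN h U)
  gcongr
  · exact traceNorm_nonneg _
  · exact hU ▸ Complex.re_le_norm _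

theorem sq_traceNorm_sub_div_le_relEntropy (hM : IsState M) (hN : IsState N) :
    ((traceNorm (M - N) ^ 2 / (2 * Real.log 2) : ℝ) : EReal) ≤ relEntropy M N := by
  rw [relEntropy]
  split_ifs with h
  · rw [EReal.coe_le_coe_iff, div_le_iff₀' (mul_pos two_pos (Real.log_pos one_lt_two))]
    refine (sq_traceNorm_sub_le hM.1 hN.1 h).trans_eq ?_
    rw [hM.2, hN.2, Complex.one_re]
    ring
  · exact le_top

theorem relEntropy_nonneg (hM : IsState M) (hN : IsState N) : 0 ≤ relEntropy M N :=
  le_trans (EReal.coe_nonneg.2 (by positivity)) (sq_traceNorm_sub_div_le_relEntropy hM hN)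

end Pinsker

section LOCC

theorem IsCompletelyPositive.map_posSemidef {m n : Type*} {Φ : Matrix m m ℂ →ₗ[ℂ] Matrix n n ℂ}
    (hΦ : IsCompletelyPositive Φ) {M : Matrix m m ℂ} (hM : M.PosSemidef) : (Φ M).PosSemidef :=
  (hΦ 1 (M.submatrix Prod.snd Prod.snd) (hM.submatrix Prod.snd)).submatrix (Prod.mk 0)

theorem isCompletelyPositive_reindex {m n : Type*} (e : m ≃ n) :
    IsCompletelyPositive (reindexLinearEquiv ℂ ℂ e e).toLinearMap :=
  fun _ _ hM => hM.submatrix (Prod.map id e.symm)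

/-- Bob does nothing, and Alice chooses her input uniformly at random. -/
noncomputable def uniformLOCC (X B : Type*) [Fintype X] [Nonempty X] [Fintype B] :
    OneWayLOCC X B where
  cardY := 1
  dimB' := Fintype.card B
  p := fun _ _ => (Fintype.card X : ℝ)⁻¹
  p_mem := fun _ => ⟨fun _ => by positivity, by simp⟩
  K := fun _ => (reindexLinearEquiv ℂ ℂ (Fintype.equivFin B) (Fintype.equivFin B)).toLinearMap
  completelyPositive := fun _ => isCompletelyPositive_reindex _
  traceNonincreasing := fun _ M _ => (congrArg Complex.re (trace_submatrix_equiv M _)).le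
  tracePreserving := fun M => by
    rw [Fin.sum_univ_one]
    exact trace_submatrix_equiv M _

/-- The index set of an output state, as pairs of an index of `B'` and a classical label. -/
def outputEquiv {X A B : Type*} [Fintype X] [Fintype B] (L : OneWayLOCC X B) :
    X × A × Fin L.dimB' × Fin L.cardY ≃ Fin L.dimB' × (X × A × Fin L.cardY) where
  toFun k := (k.2.2.1, k.1, k.2.1, k.2.2.2)
  invFun k := (k.2.1, k.2.2.1, k.1, k.2.2.2)

variable {X A B : Type*} [Fintype X] [Fintype A] [Fintype B]

/-- The trace distance of two assemblages, averaged over a uniformly random input. -/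
noncomputable def traceDist [DecidableEq B] (ρ σ : Assemblage X A B) : ℝ :=
  1 / (Fintype.card X : ℝ) * ∑ x, ∑ a, traceNorm (ρ.op a x - σ.op a x)

variable [DecidableEq X] [DecidableEq A]

theorem outputState_eq_submatrix_blockDiagonal (L : OneWayLOCC X B) (ρ : Assemblage X A B) :
    L.outputState ρ =
      (blockDiagonal fun k : X × A × Fin L.cardY =>
        (L.p k.2.2 k.1 : ℂ) • L.K k.2.2 (ρ.op k.2.1 k.1)).submatrix
          (outputEquiv L) (outputEquiv L) := by
  ext ⟨x, a, i, y⟩ ⟨x', a', i', y'⟩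
  simp only [OneWayLOCC.outputState, Matrix.sum_apply, Matrix.smul_apply, kroneckerMap_apply,
    single_apply, submatrix_apply, outputEquiv, Equiv.coe_fn_mk, blockDiagonal_apply,
    Prod.mk.injEq, smul_eq_mul]
  rw [Finset.sum_eq_single x, Finset.sum_eq_single a, Finset.sum_eq_single y]
  · by_cases hx : x = x' <;> by_cases ha : a = a' <;> by_cases hy : y = y' <;> simp [hx, ha, hy]
  all_goals intros; simp_all

theorem traceNorm_outputState_sub (L : OneWayLOCC X B) (ρ σ : Assemblage X A B) :
    traceNorm (L.outputState ρ - L.outputState σ) =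
      ∑ x, ∑ a, ∑ y, L.p y x * traceNorm (L.K y (ρ.op a x - σ.op a x)) := by
  rw [outputState_eq_submatrix_blockDiagonal, outputState_eq_submatrix_blockDiagonal]
  refine (congrArg traceNorm (congrFun₂ (submatrix_sub _ _) _ _)).symm.trans ?_
  rw [← blockDiagonal_sub, traceNorm_submatrix_equiv, traceNorm_blockDiagonal]
  simp only [Fintype.sum_prod_type, Pi.sub_apply, ← smul_sub, ← map_sub, traceNorm_smul,
    Complex.norm_of_nonneg ((L.p_mem _).1 _)]

theorem isState_outputState [Nonempty X] (L : OneWayLOCC X B) (ρ : Assemblage X A B) :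
    IsState (L.outputState ρ) := by
  rw [outputState_eq_submatrix_blockDiagonal]
  refine ⟨(posSemidef_blockDiagonal fun k => ?_).submatrix _, ?_⟩
  · exact ((L.completelyPositive _).map_posSemidef (ρ.posSemidef _ _)).smul
      (Complex.zero_le_real.2 ((L.p_mem _).1 _))
  obtain ⟨x₀⟩ := ‹Nonempty X›
  have hK (x : X) (y : Fin L.cardY) :
      ∑ a, (L.K y (ρ.op a x)).trace = (L.K y (∑ a, ρ.op a x₀)).trace := by
    rw [ρ.noSignaling x₀ x, map_sum, trace_sum]
  have hp (y : Fin L.cardY) : ∑ x, (L.p y x : ℂ) = 1 := by exact_mod_cast (L.p_mem y).2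
  rw [trace_submatrix_equiv, trace_blockDiagonal]
  calc ∑ k : X × A × Fin L.cardY, ((L.p k.2.2 k.1 : ℂ) • L.K k.2.2 (ρ.op k.2.1 k.1)).trace
      = ∑ x, ∑ y, (L.p y x : ℂ) * ∑ a, (L.K y (ρ.op a x)).trace := by
        simp only [Fintype.sum_prod_type, trace_smul, smul_eq_mul, Finset.mul_sum]
        exact Finset.sum_congr rfl fun x _ => Finset.sum_comm
    _ = (∑ y, L.K y (∑ a, ρ.op a x₀)).trace := by
        simp only [hK]
        rw [Finset.sum_comm, trace_sum]
        simp only [← Finset.sum_mul, hp, one_mul]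
    _ = 1 := by rw [L.tracePreserving, (ρ.isState x₀).2]

theorem traceNorm_outputState_uniformLOCC_sub [Nonempty X] [DecidableEq B]
    (ρ σ : Assemblage X A B) :
    traceNorm ((uniformLOCC X B).outputState ρ - (uniformLOCC X B).outputState σ) =
      traceDist ρ σ := by
  have hy (x : X) (a : A) : ∑ y, (uniformLOCC X B).p y x *
        traceNorm ((uniformLOCC X B).K y (ρ.op a x - σ.op a x)) =
      1 / (Fintype.card X : ℝ) * traceNorm (ρ.op a x - σ.op a x) := by
    rw [one_div]
    refine (Fin.sum_univ_one _).trans (congrArg _ ?_)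
    exact traceNorm_submatrix_equiv _ (Fintype.equivFin B).symm
  rw [traceNorm_outputState_sub, traceDist]
  simp only [hy, Finset.mul_sum]

end LOCC

section Caratheodory

variable {𝕜 E : Type*} [Field 𝕜] [LinearOrder 𝕜] [IsStrictOrderedRing 𝕜] [AddCommGroup E]
  [Module 𝕜 E] [FiniteDimensional 𝕜 E]

theorem exists_stdSimplex_sum_smul_eq_of_mem_convexHull {s : Set E} {x : E}
    (hx : x ∈ convexHull 𝕜 s) :
    ∃ w ∈ stdSimplex 𝕜 (Fin (Module.finrank 𝕜 E + 1)),
      ∃ z : Fin (Module.finrank 𝕜 E + 1) → E, (∀ k, z k ∈ s) ∧ ∑ k, w k • z k = x := by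
  obtain ⟨x₀, hx₀⟩ : s.Nonempty := convexHull_nonempty_iff.1 ⟨x, hx⟩
  obtain ⟨ι, _, z, w, hz, hind, hw, hw1, hwz⟩ := eq_pos_convex_span_of_mem_convexHull hx
  obtain ⟨e⟩ : Nonempty (ι ↪ Fin (Module.finrank 𝕜 E + 1)) := by
    refine Function.Embedding.nonempty_of_card_le ?_
    rw [Fintype.card_fin]
    exact hind.card_le_finrank_succ.trans (Nat.succ_le_succ (Submodule.finrank_le _))
  have hw0 : ∀ k ∉ Set.range e, Function.extend e w 0 k = 0 := fun k hk =>
    Function.extend_apply' _ _ _ hk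
  refine ⟨Function.extend e w 0, ⟨fun k => ?_, ?_⟩, Function.extend e z fun _ => x₀,
    fun k => ?_, ?_⟩
  · by_cases hk : k ∈ Set.range e
    · obtain ⟨i, rfl⟩ := hk
      exact (hw i).le.trans_eq (e.injective.extend_apply _ _ _).symm
    · exact (hw0 k hk).ge
  · rw [← hw1]
    exact (Fintype.sum_of_injective e e.injective _ _ hw0
      fun i => (e.injective.extend_apply _ _ _).symm).symm
  · by_cases hk : k ∈ Set.range e
    · obtain ⟨i, rfl⟩ := hk
      rw [e.injective.extend_apply]
      exact hz ⟨i, rfl⟩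
    · rwa [Function.extend_apply' _ _ _ hk]
  · rw [← hwz]
    refine (Fintype.sum_of_injective e e.injective _ _ (fun k hk => ?_) fun i => ?_).symm
    · rw [hw0 k hk, zero_smul]
    · rw [e.injective.extend_apply, e.injective.extend_apply]

theorem convexHull_eq_image_stdSimplex_prod (s : Set E) :
    convexHull 𝕜 s = (fun p : (Fin (Module.finrank 𝕜 E + 1) → 𝕜) ×
        (Fin (Module.finrank 𝕜 E + 1) → E) => ∑ k, p.1 k • p.2 k) ''
      (stdSimplex 𝕜 (Fin (Module.finrank 𝕜 E + 1)) ×ˢ Set.univ.pi fun _ => s) := by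
  refine Set.Subset.antisymm (fun x hx => ?_) ?_
  · obtain ⟨w, hw, z, hz, hwz⟩ := exists_stdSimplex_sum_smul_eq_of_mem_convexHull hx
    exact ⟨(w, z), ⟨hw, fun k _ => hz k⟩, hwz⟩
  · rintro _ ⟨⟨w, z⟩, ⟨hw, hz⟩, rfl⟩
    exact (convex_convexHull 𝕜 s).sum_mem (fun k _ => hw.1 k) hw.2
      fun k _ => subset_convexHull 𝕜 s (hz k trivial)

end Caratheodory

theorem isCompact_convexHull_of_finiteDimensional {E : Type*} [AddCommGroup E] [Module ℝ E]
    [FiniteDimensional ℝ E] [TopologicalSpace E] [ContinuousAdd E] [ContinuousSMul ℝ E]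
    {s : Set E} (hs : IsCompact s) : IsCompact (convexHull ℝ s) := by
  rw [convexHull_eq_image_stdSimplex_prod]
  refine ((isCompact_stdSimplex ℝ _).prod (isCompact_univ_pi fun _ => hs)).image ?_
  fun_prop

section LHS

theorem isClosed_setOf_isState (n : Type*) [Fintype n] :
    IsClosed {M : Matrix n n ℂ | IsState M} := by
  simp only [IsState, posSemidef_iff_dotProduct_mulVec, IsHermitian, Set.ofPred_and,
    Set.ofPred_forall]
  refine ((isClosed_eq (by fun_prop) (by fun_prop)).inter (isClosed_iInter fun x => ?_)).inter
    (isClosed_eq (by fun_prop) (by fun_prop))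
  exact isClosed_le continuous_const (by fun_prop)

theorem isCompact_setOf_isState (n : Type*) [Fintype n] :
    IsCompact {M : Matrix n n ℂ | IsState M} := by
  classical
  have hK : IsCompact (Set.univ.pi fun _ : n => Set.univ.pi fun _ : n =>
      Metric.closedBall (0 : ℂ) 1) :=
    isCompact_univ_pi fun _ => isCompact_univ_pi fun _ => isCompact_closedBall 0 1
  refine hK.of_isClosed_subset (isClosed_setOf_isState n) fun M hM i _ j _ => ?_
  rw [mem_closedBall_zero_iff, ← Complex.one_re, ← hM.2, ← traceNorm_of_posSemidef hM.1]
  exact norm_apply_le_traceNorm M i j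

/-- The local-hidden-state models with a single hidden state: families `(q(a|x) τ)` with a
response function `q` and a state `τ`. -/
def responseFamilies (X A B : Type*) [Fintype A] [Fintype B] : Set (A → X → Matrix B B ℂ) :=
  (fun p : (X → A → ℝ) × Matrix B B ℂ => fun a x => p.1 x a • p.2) ''
    ((Set.univ.pi fun _ => stdSimplex ℝ A) ×ˢ {τ | IsState τ})

variable {X A B : Type*} [Fintype A] [Fintype B]

theorem isCompact_responseFamilies : IsCompact (responseFamilies X A B) := by
  refine ((isCompact_univ_pi fun _ => isCompact_stdSimplex ℝ A).prod
    (isCompact_setOf_isState B)).image ?_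
  fun_prop

theorem mem_LHS_iff [Finite X] {ρ : Assemblage X A B} :
    ρ ∈ LHS X A B ↔ ρ.op ∈ convexHull ℝ (responseFamilies X A B) := by
  constructor
  · rintro ⟨n, p, q, τ, hp, hq, hτ, h⟩
    refine mem_convexHull_of_exists_fintype p (fun l a x => q l x a • τ l) hp.1 hp.2
      (fun l => ⟨(q l, τ l), ⟨fun x _ => hq l x, hτ l⟩, rfl⟩) ?_
    funext a x
    simp only [h, Finset.sum_apply, Pi.smul_apply, Complex.coe_smul, mul_smul]
  · intro h
    obtain ⟨w, hw, z, hz, hwz⟩ := exists_stdSimplex_sum_smul_eq_of_mem_convexHull h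
    choose f hf hfz using hz
    refine ⟨_, w, fun l => (f l).1, fun l => (f l).2, hw, fun l x => (hf l).1 x trivial,
      fun l => (hf l).2, fun a x => ?_⟩
    simp only [← hwz, ← hfz, Finset.sum_apply, Pi.smul_apply, Complex.coe_smul, mul_smul]

variable [Fintype X] [DecidableEq B]

theorem traceDist_nonneg (ρ σ : Assemblage X A B) : 0 ≤ traceDist ρ σ :=
  mul_nonneg (by positivity) (Finset.sum_nonneg fun _ _ => Finset.sum_nonneg fun _ _ =>
    traceNorm_nonneg _)

theorem norm_op_sub_op_apply_le (ρ σ : Assemblage X A B) (a : A) (x : X) (i j : B) :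
    ‖ρ.op a x i j - σ.op a x i j‖ ≤ Fintype.card X * traceDist ρ σ := by
  have : Nonempty X := ⟨x⟩
  calc ‖ρ.op a x i j - σ.op a x i j‖ ≤ traceNorm (ρ.op a x - σ.op a x) :=
        norm_apply_le_traceNorm (ρ.op a x - σ.op a x) i j
    _ ≤ ∑ a, traceNorm (ρ.op a x - σ.op a x) :=
        Finset.single_le_sum (f := fun a => traceNorm (ρ.op a x - σ.op a x))
          (fun _ _ => traceNorm_nonneg _) (Finset.mem_univ a)
    _ ≤ ∑ x, ∑ a, traceNorm (ρ.op a x - σ.op a x) :=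
        Finset.single_le_sum (f := fun x => ∑ a, traceNorm (ρ.op a x - σ.op a x))
          (fun _ _ => Finset.sum_nonneg fun _ _ => traceNorm_nonneg _) (Finset.mem_univ x)
    _ = Fintype.card X * traceDist ρ σ := by
        rw [traceDist, ← mul_assoc, mul_one_div_cancel (Nat.cast_ne_zero.2 Fintype.card_ne_zero),
          one_mul]

theorem mem_LHS_of_iInf_traceDist_eq_zero {ρ : Assemblage X A B}
    (h : ⨅ σ ∈ LHS X A B, ENNReal.ofReal (traceDist ρ σ) = 0) : ρ ∈ LHS X A B := by
  have hex (k : ℕ) : ∃ σ ∈ LHS X A B, traceDist ρ σ < 1 / ((k : ℝ) + 1) := by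
    have hk : ⨅ σ ∈ LHS X A B, ENNReal.ofReal (traceDist ρ σ) <
        ENNReal.ofReal (1 / ((k : ℝ) + 1)) := by
      rw [h]
      exact ENNReal.ofReal_pos.2 Nat.one_div_pos_of_nat
    simp only [iInf_lt_iff] at hk
    obtain ⟨σ, hσ, hlt⟩ := hk
    exact ⟨σ, hσ, (ENNReal.ofReal_lt_ofReal_iff_of_nonneg (traceDist_nonneg ρ σ)).1 hlt⟩
  choose σ hσ hlt using hex
  refine mem_LHS_iff.2 ((isCompact_convexHull_of_finiteDimensional
    isCompact_responseFamilies).isClosed.mem_of_tendsto (f := fun k => (σ k).op)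
    (b := Filter.atTop) ?_ (Filter.Eventually.of_forall fun k => mem_LHS_iff.1 (hσ k)))
  refine tendsto_pi_nhds.2 fun a => tendsto_pi_nhds.2 fun x => tendsto_pi_nhds.2 fun i =>
    tendsto_pi_nhds.2 fun j => tendsto_iff_norm_sub_tendsto_zero.2 ?_
  have hlim := tendsto_one_div_add_atTop_nhds_zero_nat.const_mul (Fintype.card X : ℝ)
  rw [mul_zero] at hlim
  refine squeeze_zero (fun _ => norm_nonneg _) (fun k => ?_) hlim
  rw [norm_sub_rev]
  exact (norm_op_sub_op_apply_le ρ (σ k) a x i j).trans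
    (mul_le_mul_of_nonneg_left (hlt k).le (Nat.cast_nonneg _))

end LHS

section Faithfulness

variable {X A B : Type*} [Fintype X] [DecidableEq X] [Nonempty X] [Fintype A] [DecidableEq A]
  [Fintype B]

theorem sq_traceDist_div_le_relEntropy_outputState [DecidableEq B] (ρ σ : Assemblage X A B) :
    ((traceDist ρ σ ^ 2 / (2 * Real.log 2) : ℝ) : EReal) ≤
      relEntropy ((uniformLOCC X B).outputState ρ) ((uniformLOCC X B).outputState σ) := by
  rw [← traceNorm_outputState_uniformLOCC_sub]
  exact sq_traceNorm_sub_div_le_relEntropy (isState_outputState _ ρ) (isState_outputState _ σ)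

theorem relEntropySteering_nonneg (ρ : Assemblage X A B) : 0 ≤ relEntropySteering ρ :=
  le_iSup_of_le (uniformLOCC X B) (le_iInf₂ fun σ _ =>
    relEntropy_nonneg (isState_outputState _ ρ) (isState_outputState _ σ))

theorem sq_iInf_traceDist_div_le_relEntropySteering [DecidableEq B] (ρ : Assemblage X A B) :
    (((⨅ σ ∈ LHS X A B, ENNReal.ofReal (traceDist ρ σ)) ^ 2 /
      ENNReal.ofReal (2 * Real.log 2) : ℝ≥0∞) : EReal) ≤ relEntropySteering ρ := by
  have hlog : 0 < 2 * Real.log 2 := mul_pos two_pos (Real.log_pos one_lt_two)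
  refine le_iSup_of_le (uniformLOCC X B) (le_iInf₂ fun σ hσ => ?_)
  refine le_trans ?_ (sq_traceDist_div_le_relEntropy_outputState ρ σ)
  rw [← max_eq_left (div_nonneg (sq_nonneg (traceDist ρ σ)) hlog.le), ← EReal.coe_ennreal_ofReal,
    EReal.coe_ennreal_le_coe_ennreal_iff, ENNReal.ofReal_div_of_pos hlog,
    ENNReal.ofReal_pow (traceDist_nonneg ρ σ)]
  gcongr
  exact iInf₂_le σ hσ

theorem iInf_traceDist_le [DecidableEq B] (ρ : Assemblage X A B) :
    ⨅ σ ∈ LHS X A B, ENNReal.ofReal (traceDist ρ σ) ≤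
      (ENNReal.ofReal (2 * Real.log 2) * (relEntropySteering ρ).toENNReal) ^ (1 / 2 : ℝ) := by
  have hlog : 0 < 2 * Real.log 2 := mul_pos two_pos (Real.log_pos one_lt_two)
  have hle := EReal.toENNReal_le_toENNReal (sq_iInf_traceDist_div_le_relEntropySteering ρ)
  rw [EReal.toENNReal_coe, ENNReal.div_le_iff_le_mul (Or.inl (ENNReal.ofReal_pos.2 hlog).ne')
    (Or.inl ENNReal.ofReal_ne_top), mul_comm] at hle
  rw [one_div, ENNReal.le_rpow_inv_iff two_pos]
  exact_mod_cast hle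

end Faithfulness

end Steering

theorem mainTheorem4 {X A B : Type*} [Fintype X] [DecidableEq X] [Nonempty X]
    [Fintype A] [DecidableEq A] [Fintype B] [DecidableEq B]
    (ρ : Steering.Assemblage X A B) :
    0 ≤ Steering.relEntropySteering ρ ∧
    (⨅ σ ∈ Steering.LHS X A B, ENNReal.ofReal
        (1 / (Fintype.card X : ℝ) * ∑ x, ∑ a, Steering.traceNorm (ρ.op a x - σ.op a x))) ≤
      (ENNReal.ofReal (2 * Real.log 2) * (Steering.relEntropySteering ρ).toENNReal)
        ^ (1 / 2 : ℝ) ∧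
    (Steering.relEntropySteering ρ = 0 → ρ ∈ Steering.LHS X A B) := by
  refine ⟨Steering.relEntropySteering_nonneg ρ, Steering.iInf_traceDist_le ρ, fun hR => ?_⟩
  refine Steering.mem_LHS_of_iInf_traceDist_eq_zero (nonpos_iff_eq_zero.1 ?_)
  simpa [hR] using Steering.iInf_traceDist_le ρ
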